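/- Let $q,\sigma:[0,\infty)\to\mathbb{R}$ be continuous functions with $\sigma(t)\neq 0$ for all $t\ge 0$, and let $(Z_t)_{t\ge0}$ be the Ornstein--Uhlenbeck type process given by $$dZ_t=q(t)\,Z_t\,dt+\sigma(t)\,dB_t,\qquad t\ge 0,$$ where $(B_t)_{t\ge0}$ is a standard Wiener process and $Z_0$ is a Gaussian (possibly degenerate) random variable independent of $B$. Let $T>0$ be fixed and suppose that $q$ is continuously differentiable on $[0,T)$. Put $\bar q(t)=\int_0^t q(u)\,du$ and $\gamma(s,t)=\int_s^t e^{2(\bar q(t)-\bar q(u))}\sigma(u)^2\,du$ for $0\le s\le t$. The bridge from $0$ to $0$ over $[0,T]$ derived from $Z$ is any almost surely continuous process on $[0,T]$ with the same finite-dimensional distributions as the almost surely continuous process $(U_t)_{t\in[0,T]}$ with $$U_t=\int_0^t\frac{\gamma(t,T)}{\gamma(s,T)}\,e^{\bar q(t)-\bar q(s)}\,\sigma(s)\,dB_s,\quad t\in[0,T),\qquad U_T=0;$$ the usual Wiener bridge from $0$ to $0$ over $[0,T]$ is any almost surely continuous process on $[0,T]$ with the same finite-dimensional distributions as the almost surely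 continuous process $(W_t)_{t\in[0,T]}$ with $W_t=\int_0^t\frac{T-t}{T-s}\,dB'_s$ for $t\in[0,T)$ and $W_T=0$, where $B'$ is a standard Wiener process. Then the law of the bridge from $0$ to $0$ over $[0,T]$ derived from $Z$ coincides with the law of the usual Wiener bridge from $0$ to $0$ over $[0,T]$ if and only if both of the following hold: 1. $q(t)=\dfrac{1}{t+C}$ for all $t\in[0,T)$, with some $C\in(\mathbb{R}\setminus[-T,0])\cup\{+\infty\}$, where $C=+\infty$ means that $q(t)=0$ for all $t\in[0,T)$; 2. $\sigma(t)=1$ for all $t\in[0,T)$, or $\sigma(t)=-1$ for all $t\in[0,T)$. -/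

import Mathlib

open MeasureTheory ProbabilityTheory Filter Topology
open scoped NNReal ENNReal

noncomputable section

namespace OUBridge

/-! ### Wiener integrals of deterministic functions -/

/-- A step function `s ↦ ∑ i, val i * 1_{(lo i, hi i]}(s)` on `(0, t]`. -/
structure StepFunction (t : ℝ) where
  /-- the number of terms -/
  n : ℕ
  /-- the left end points -/
  lo : Fin n → ℝ≥0
  /-- the right end points -/
  hi : Fin n → ℝ≥0
  /-- the coefficients -/
  val : Fin n → ℝ
  lo_le_hi : ∀ i, lo i ≤ hi i
  hi_le : ∀ i, (hi i : ℝ) ≤ t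

/-- The value of a step function at `s`. -/
def StepFunction.eval {t : ℝ} (φ : StepFunction t) (s : ℝ) : ℝ :=
  ∑ i, (Set.Ioc (φ.lo i : ℝ) (φ.hi i : ℝ)).indicator (fun _ => φ.val i) s

/-- The elementary stochastic integral `∑ i, val i * (B_{hi i} - B_{lo i})` of a step function. -/
def StepFunction.integral {t : ℝ} (φ : StepFunction t) {Ω : Type*} (B : ℝ≥0 → Ω → ℝ)
    (ω : Ω) : ℝ :=
  ∑ i, φ.val i * (B (φ.hi i) ω - B (φ.lo i) ω)

/-- `J` is (a version of) the stochastic integral `∫₀ᵗ f(s) dB_s` of the deterministic function `f`: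
there are step functions `φ k → f` in `L²((0, t], ds)` whose elementary integrals converge to `J`
in `L²(P)`. -/
def IsWienerIntegral {Ω : Type*} [MeasurableSpace Ω] (B : ℝ≥0 → Ω → ℝ) (P : Measure Ω)
    (f : ℝ → ℝ) (t : ℝ) (J : Ω → ℝ) : Prop :=
  ∃ φ : ℕ → StepFunction t,
    Tendsto (fun k => eLpNorm (fun s => (φ k).eval s - f s) 2 (volume.restrict (Set.Ioc 0 t)))
      atTop (𝓝 0) ∧
    Tendsto (fun k => eLpNorm (fun ω => (φ k).integral B ω - J ω) 2 P) atTop (𝓝 0)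

/-! ### Processes of Ornstein-Uhlenbeck type -/

/-- `Z` is a process of Ornstein-Uhlenbeck type with coefficients `q` and `σ`, driven by the standard
Wiener process `B`: it has almost surely continuous paths, its initial value is Gaussian (possibly
degenerate) and independent of `B`, and for every `t ≥ 0`, almost surely
`Z_t = Z_0 + ∫₀ᵗ q(u) Z_u du + ∫₀ᵗ σ(u) dB_u`. -/
structure IsOUTypeProcess {Ω : Type*} [MeasurableSpace Ω] (P : Measure Ω) (B : ℝ≥0 → Ω → ℝ)
    (q σ : ℝ → ℝ) (Z : ℝ≥0 → Ω → ℝ) : Prop where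
  isBrownian : IsBrownianReal B P
  measurable : ∀ t, Measurable (Z t)
  continuous : ∀ᵐ ω ∂P, Continuous (fun t => Z t ω)
  gaussian_init : HasGaussianLaw (Z 0) P
  indep_init : IndepFun (Z 0) (fun ω t => B t ω) P
  sde : ∀ t : ℝ≥0, IsWienerIntegral B P σ t
    (fun ω => Z t ω - Z 0 ω - ∫ u in (0 : ℝ)..t, q u * Z u.toNNReal ω)

/-- `q̄(t) = ∫₀ᵗ q(u) du`. -/
def qbar (q : ℝ → ℝ) (t : ℝ) : ℝ := ∫ u in (0 : ℝ)..t, q u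

/-- `γ(s,t) = ∫ₛᵗ exp(2(q̄(t) - q̄(u))) σ(u)² du`, the conditional variance of `Z_t` given `Z_s`. -/
def gam (q σ : ℝ → ℝ) (s t : ℝ) : ℝ :=
  ∫ u in s..t, Real.exp (2 * (qbar q t - qbar q u)) * σ u ^ 2

/-! ### Bridges -/

/-- A real process on `[0, T]` with almost surely continuous paths. -/
structure IsContProcess {Ω : Type*} [MeasurableSpace Ω] (P : Measure Ω) {T : ℝ}
    (X : Set.Icc (0 : ℝ) T → Ω → ℝ) : Prop where
  measurable : ∀ t, Measurable (X t)
  continuous : ∀ᵐ ω ∂P, Continuous (fun t => X t ω)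

/-- Two processes, possibly on different probability spaces, have the same finite-dimensional
distributions. -/
def SameFDD {ι Ω Ω' : Type*} [MeasurableSpace Ω] [MeasurableSpace Ω'] (P : Measure Ω)
    (P' : Measure Ω') (X : ι → Ω → ℝ) (Y : ι → Ω' → ℝ) : Prop :=
  ∀ I : Finset ι, IdentDistrib (fun ω => I.restrict (fun t => X t ω))
    (fun ω => I.restrict (fun t => Y t ω)) P P'

/-- The mean `n_{a,b}(0,t) = (γ(0,t)/γ(0,T)) e^{q̄(T)-q̄(t)} b + (γ(t,T)/γ(0,T)) e^{q̄(t)-q̄(0)} a`. -/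
def bridgeMean (q σ : ℝ → ℝ) (T a b t : ℝ) : ℝ :=
  gam q σ 0 t / gam q σ 0 T * Real.exp (qbar q T - qbar q t) * b
    + gam q σ t T / gam q σ 0 T * Real.exp (qbar q t - qbar q 0) * a

/-- `U` is the almost surely continuous process on `[0, T]` with `U_T = b` and
`U_t = n_{a,b}(0,t) + ∫₀ᵗ (γ(t,T)/γ(s,T)) e^{q̄(t)-q̄(s)} σ(s) dB_s` for `0 ≤ t < T`. -/
structure IsIntegralOUBridge {Ω : Type*} [MeasurableSpace Ω] (P : Measure Ω) (B : ℝ≥0 → Ω → ℝ)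
    (q σ : ℝ → ℝ) (T a b : ℝ) (U : Set.Icc (0 : ℝ) T → Ω → ℝ) : Prop
    extends IsContProcess P U where
  integral_rep : ∀ t : Set.Icc (0 : ℝ) T, (t : ℝ) < T → IsWienerIntegral B P
    (fun s => gam q σ t T / gam q σ s T * Real.exp (qbar q t - qbar q s) * σ s) t
    (fun ω => U t ω - bridgeMean q σ T a b t)
  terminal : ∀ t : Set.Icc (0 : ℝ) T, (t : ℝ) = T → ∀ᵐ ω ∂P, U t ω = b

/-- `U`, a process on `(Ω', P')`, is a bridge from `a` to `b` over `[0, T]` derived from the process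
of Ornstein-Uhlenbeck type `Z` with coefficients `q`, `σ` driven by `B` on `(Ω, P)`: it is almost
surely continuous and has the finite-dimensional distributions of the process given by the integral
representation. -/
structure IsOUBridge {Ω Ω' : Type*} [MeasurableSpace Ω] [MeasurableSpace Ω'] (P : Measure Ω)
    (B : ℝ≥0 → Ω → ℝ) (q σ : ℝ → ℝ) (Z : ℝ≥0 → Ω → ℝ) (T a b : ℝ)
    (P' : Measure Ω') (U : Set.Icc (0 : ℝ) T → Ω' → ℝ) : Prop
    extends IsContProcess P' U where
  isOU : IsOUTypeProcess P B q σ Z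
  sameFDD : ∃ V : Set.Icc (0 : ℝ) T → Ω → ℝ,
    IsIntegralOUBridge P B q σ T a b V ∧ SameFDD P P' V U

/-- `W` is the almost surely continuous process on `[0, T]` with `W_T = b` and
`W_t = a + (b - a) t / T + ∫₀ᵗ (T - t)/(T - s) dB_s` for `0 ≤ t < T`. -/
structure IsIntegralWienerBridge {Ω : Type*} [MeasurableSpace Ω] (P : Measure Ω)
    (B : ℝ≥0 → Ω → ℝ) (T a b : ℝ) (W : Set.Icc (0 : ℝ) T → Ω → ℝ) : Prop
    extends IsContProcess P W where
  integral_rep : ∀ t : Set.Icc (0 : ℝ) T, (t : ℝ) < T → IsWienerIntegral B P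
    (fun s => (T - t) / (T - s)) t (fun ω => W t ω - (a + (b - a) * (t / T)))
  terminal : ∀ t : Set.Icc (0 : ℝ) T, (t : ℝ) = T → ∀ᵐ ω ∂P, W t ω = b

/-- `W`, a process on `(Ω', P')`, is a usual Wiener bridge from `a` to `b` over `[0, T]`: it is almost
surely continuous and has the finite-dimensional distributions of the process built from the standard
Wiener process `B` on `(Ω, P)` by the integral representation. -/
structure IsWienerBridge {Ω Ω' : Type*} [MeasurableSpace Ω] [MeasurableSpace Ω'] (P : Measure Ω)
    (B : ℝ≥0 → Ω → ℝ) (T a b : ℝ) (P' : Measure Ω') (W : Set.Icc (0 : ℝ) T → Ω' → ℝ) : Prop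
    extends IsContProcess P' W where
  isBrownian : IsBrownianReal B P
  sameFDD : ∃ V : Set.Icc (0 : ℝ) T → Ω → ℝ,
    IsIntegralWienerBridge P B T a b V ∧ SameFDD P P' V W

end OUBridge

end

/-! Both bridges are centred Gaussian processes, being `L²` limits of elementary integrals, so their
laws agree exactly when their covariances do (`sameFDD_iff_bridgeCov_eq`).

Write `A = exp q̄` and `H(t) = ∫ₜᵀ A⁻² σ²`. The kernel factors as `A(t) H(t)` times `σ(s) / (A(s)
H(s))`, and the square of the second factor is the derivative of `1/H`. The Itô isometry therefore
gives the covariance `A(s) (H(0) - H(s)) · A(t) H(t) / H(0)` for `s ≤ t`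
(`setIntegral_bridgeKernel_mul`), to be compared with `s (T - t) / T`.

Both sides are a function of `s` times a function of `t`. Separating variables and using `A(0) = 1`
gives `A (H(0) - H) = t` and `A H = κ (T - t)` with `κ = H(0)/T`. Adding the two shows that `A = 1 +
c t` is affine, so `q = A'/A = c / (1 + c t)`; differentiating the second yields `σ² = 1`, and
continuity fixes the sign of `σ`. Here `C = 1/c`, the case `c = 0` is `C = +∞`, and positivity of
`A` on `[0, T]` is the condition `C ∉ [-T, 0]`. The converse is a direct computation
(`bridgeCov_of_eq_div`). -/

noncomputable section

namespace OUBridge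

/-! ### `L²` limits. -/

section L2

variable {α : Type*} {mα : MeasurableSpace α} {μ : Measure α}

lemma memLp_two_of_tendsto {f : ℕ → α → ℝ} {g : α → ℝ} (hf : ∀ k, MemLp (f k) 2 μ)
    (hg : AEStronglyMeasurable g μ)
    (h : Tendsto (fun k => eLpNorm (fun x => f k x - g x) 2 μ) atTop (𝓝 0)) : MemLp g 2 μ := by
  obtain ⟨k, hk⟩ := (h.eventually (gt_mem_nhds zero_lt_one)).exists
  have h1 : MemLp (fun x => f k x - g x) 2 μ :=
    ⟨(hf k).aestronglyMeasurable.sub hg, hk.trans ENNReal.one_lt_top⟩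
  have h2 : f k - (fun x => f k x - g x) = g := by ext x; simp
  exact h2 ▸ (hf k).sub h1

lemma tendsto_integral_mul_of_tendsto_eLpNorm {f f' : ℕ → α → ℝ} {g g' : α → ℝ}
    (hf : ∀ k, MemLp (f k) 2 μ) (hf' : ∀ k, MemLp (f' k) 2 μ) (hg : MemLp g 2 μ)
    (hg' : MemLp g' 2 μ)
    (h : Tendsto (fun k => eLpNorm (fun x => f k x - g x) 2 μ) atTop (𝓝 0))
    (h' : Tendsto (fun k => eLpNorm (fun x => f' k x - g' x) 2 μ) atTop (𝓝 0)) :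
    Tendsto (fun k => ∫ x, f k x * f' k x ∂μ) atTop (𝓝 (∫ x, g x * g' x ∂μ)) := by
  have key : ∀ {u v : α → ℝ} (hu : MemLp u 2 μ) (hv : MemLp v 2 μ),
      inner ℝ (hu.toLp u) (hv.toLp v) = ∫ x, u x * v x ∂μ := by
    intro u v hu hv
    rw [L2.inner_def]
    refine integral_congr_ae ?_
    filter_upwards [hu.coeFn_toLp, hv.coeFn_toLp] with x h1 h2
    rw [h1, h2]
    simp [mul_comm]
  have := ((Lp.tendsto_Lp_iff_tendsto_eLpNorm'' f hf g hg).2 h).inner (𝕜 := ℝ)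
    ((Lp.tendsto_Lp_iff_tendsto_eLpNorm'' f' hf' g' hg').2 h')
  simpa only [key] using this

lemma tendsto_eLpNorm_sum_mul_sub {ι : Type*} (s : Finset ι) (c : ι → ℝ) {f : ℕ → ι → α → ℝ}
    {g : ι → α → ℝ} (hf : ∀ k i, AEStronglyMeasurable (f k i) μ)
    (hg : ∀ i, AEStronglyMeasurable (g i) μ)
    (h : ∀ i, Tendsto (fun k => eLpNorm (fun x => f k i x - g i x) 2 μ) atTop (𝓝 0)) :
    Tendsto (fun k => eLpNorm (fun x => ∑ i ∈ s, c i * f k i x - ∑ i ∈ s, c i * g i x) 2 μ)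
      atTop (𝓝 0) := by
  have hlim : Tendsto (fun k => ∑ i ∈ s, ‖c i‖ₑ * eLpNorm (fun x => f k i x - g i x) 2 μ)
      atTop (𝓝 0) := by
    have : (0 : ℝ≥0∞) = ∑ i ∈ s, ‖c i‖ₑ * 0 := by simp
    rw [this]
    exact tendsto_finsetSum _ fun i _ => ENNReal.Tendsto.const_mul (h i) (Or.inr enorm_ne_top)
  refine tendsto_of_tendsto_of_tendsto_of_le_of_le tendsto_const_nhds hlim
    (fun _ => zero_le) fun k => ?_
  have h1 : (fun x => ∑ i ∈ s, c i * f k i x - ∑ i ∈ s, c i * g i x)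
      = ∑ i ∈ s, c i • fun x => f k i x - g i x := by
    ext x
    simp [Finset.sum_apply, mul_sub]
  rw [h1]
  refine (eLpNorm_sum_le (fun i _ => (((hf k i).sub (hg i)).const_smul _)) (by norm_num)).trans ?_
  exact Finset.sum_le_sum fun i _ => (eLpNorm_const_smul (c i) _ 2 μ).le

end L2

/-! ### Gaussian processes: closure under `L²` limits, determination by mean and covariance. -/

section Gaussian

variable {Ω : Type*} {mΩ : MeasurableSpace Ω} {P : Measure Ω} [IsProbabilityMeasure P]

lemma tendsto_integral_of_tendsto_eLpNorm {f : ℕ → Ω → ℝ} {g : Ω → ℝ}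
    (hf : ∀ k, MemLp (f k) 2 P) (hg : MemLp g 2 P)
    (h : Tendsto (fun k => eLpNorm (fun x => f k x - g x) 2 P) atTop (𝓝 0)) :
    Tendsto (fun k => P[f k]) atTop (𝓝 P[g]) := by
  simpa using tendsto_integral_mul_of_tendsto_eLpNorm hf (fun _ => memLp_const (1 : ℝ)) hg
    (memLp_const (1 : ℝ)) h (by simp)

lemma tendsto_covariance_of_tendsto_eLpNorm {f f' : ℕ → Ω → ℝ} {g g' : Ω → ℝ}
    (hf : ∀ k, MemLp (f k) 2 P) (hf' : ∀ k, MemLp (f' k) 2 P) (hg : MemLp g 2 P)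
    (hg' : MemLp g' 2 P)
    (h : Tendsto (fun k => eLpNorm (fun x => f k x - g x) 2 P) atTop (𝓝 0))
    (h' : Tendsto (fun k => eLpNorm (fun x => f' k x - g' x) 2 P) atTop (𝓝 0)) :
    Tendsto (fun k => cov[f k, f' k; P]) atTop (𝓝 cov[g, g'; P]) := by
  simp_rw [covariance_eq_sub hg hg', fun k => covariance_eq_sub (hf k) (hf' k)]
  exact (tendsto_integral_mul_of_tendsto_eLpNorm hf hf' hg hg' h h').sub
    ((tendsto_integral_of_tendsto_eLpNorm hf hg h).mul
      (tendsto_integral_of_tendsto_eLpNorm hf' hg' h'))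

lemma exists_forall_eq_sum_mul {ι : Type*} [Fintype ι] (L : StrongDual ℝ (ι → ℝ)) :
    ∃ c : ι → ℝ, ∀ x, L x = ∑ i, c i * x i := by
  classical
  refine ⟨fun i => L (Pi.single i 1), fun x => ?_⟩
  conv_lhs => rw [← L.sum_comp_single]
  refine Finset.sum_congr rfl fun i _ => ?_
  have : Pi.single i (x i) = x i • (Pi.single i 1 : ι → ℝ) := by
    rw [← Pi.single_smul]; simp
  simp [this, mul_comm]

/-- An `L²` limit of real Gaussian random variables is Gaussian. -/
lemma hasGaussianLaw_of_tendsto_eLpNorm {X : ℕ → Ω → ℝ} {Y : Ω → ℝ}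
    (hX : ∀ k, HasGaussianLaw (X k) P) (hY : AEMeasurable Y P)
    (h : Tendsto (fun k => eLpNorm (fun ω => X k ω - Y ω) 2 P) atTop (𝓝 0)) :
    HasGaussianLaw Y P := by
  have hX2 : ∀ k, MemLp (X k) 2 P := fun k => (hX k).memLp_two
  have hY2 : MemLp Y 2 P := memLp_two_of_tendsto hX2 hY.aestronglyMeasurable h
  have hmean := tendsto_integral_of_tendsto_eLpNorm hX2 hY2 h
  have hvar : Tendsto (fun k => Var[X k; P]) atTop (𝓝 Var[Y; P]) := by
    simp_rw [← covariance_self hY, fun k => (covariance_self (hX k).aemeasurable).symm]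
    exact tendsto_covariance_of_tendsto_eLpNorm hX2 hX2 hY2 hY2 h h
  have hdist : TendstoInDistribution X atTop Y (fun _ => P) P :=
    (tendstoInMeasure_of_tendsto_eLpNorm (p := 2) (by norm_num)
      (fun k => (hX k).aemeasurable.aestronglyMeasurable) hY.aestronglyMeasurable
      h).tendstoInDistribution fun k => (hX k).aemeasurable
  -- The characteristic functions converge to that of `Y`, and also to the Gaussian one with the
  -- limiting mean and variance; the two limits coincide.
  have hchar := ProbabilityMeasure.tendsto_iff_tendsto_charFun.1 hdist.tendsto
  have : IsProbabilityMeasure (P.map Y) := Measure.isProbabilityMeasure_map hY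
  have heq : P.map Y = gaussianReal P[Y] Var[Y; P].toNNReal := by
    refine Measure.ext_of_charFun (funext fun t => ?_)
    refine tendsto_nhds_unique (hchar t) ?_
    simp only [ProbabilityMeasure.coe_mk, fun k => (hX k).map_eq_gaussianReal,
      charFun_gaussianReal, Real.coe_toNNReal _ (variance_nonneg _ _)]
    refine (Complex.continuous_exp.tendsto _).comp (Tendsto.sub ?_ ?_)
    · exact ((Complex.continuous_ofReal.tendsto _).comp hmean).const_mul _ |>.mul_const _
    · exact (((Complex.continuous_ofReal.tendsto _).comp hvar).mul_const _).div_const _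
  exact ⟨heq ▸ inferInstance⟩

/-- A pointwise `L²` limit of real Gaussian processes is a Gaussian process. -/
lemma isGaussianProcess_of_tendsto_eLpNorm {ι : Type*} {X : ℕ → ι → Ω → ℝ} {Y : ι → Ω → ℝ}
    (hX : ∀ k, IsGaussianProcess (X k) P) (hY : ∀ i, AEMeasurable (Y i) P)
    (h : ∀ i, Tendsto (fun k => eLpNorm (fun ω => X k i ω - Y i ω) 2 P) atTop (𝓝 0)) :
    IsGaussianProcess Y P where
  hasGaussianLaw I := by
    classical
    -- Cramér–Wold: every linear functional of finitely many coordinates is a one-dimensional `L²`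
    -- limit of Gaussians.
    refine ⟨isGaussian_of_isGaussian_map fun L => ?_⟩
    have hYI : AEMeasurable (fun ω => I.restrict (Y · ω)) P :=
      aemeasurable_pi_lambda _ fun i => hY i
    rw [AEMeasurable.map_map_of_aemeasurable (by fun_prop) hYI]
    obtain ⟨c, hL⟩ := exists_forall_eq_sum_mul L
    have := hasGaussianLaw_of_tendsto_eLpNorm
      (X := fun k => L ∘ fun ω => I.restrict (X k · ω)) (Y := L ∘ fun ω => I.restrict (Y · ω))
      (fun k => ((hX k).hasGaussianLaw I).map L) (by fun_prop) (by
        simp only [Function.comp_apply, hL, Finset.restrict]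
        exact tendsto_eLpNorm_sum_mul_sub (f := fun k (i : I) => X k i) (g := fun i : I => Y i) _ _
          (fun k i => ((hX k).aemeasurable i).aestronglyMeasurable)
          (fun i => (hY i).aestronglyMeasurable) (fun i => h i))
    exact this.isGaussian_map

/-- Real Gaussian processes with the same means and covariances have the same finite-dimensional
distributions. -/
lemma sameFDD_of_isGaussianProcess {Ω' : Type*} {mΩ' : MeasurableSpace Ω'} {P' : Measure Ω'}
    [IsProbabilityMeasure P'] {ι : Type*} {X : ι → Ω → ℝ} {Y : ι → Ω' → ℝ}
    (hX : IsGaussianProcess X P) (hY : IsGaussianProcess Y P')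
    (hmean : ∀ i, P[X i] = P'[Y i]) (hcov : ∀ i j, cov[X i, X j; P] = cov[Y i, Y j; P']) :
    SameFDD P P' X Y := by
  classical
  intro I
  have hXI := hX.hasGaussianLaw I
  have hYI := hY.hasGaussianLaw I
  refine ⟨hXI.aemeasurable, hYI.aemeasurable, ?_⟩
  have := hXI.isGaussian_map
  have := hYI.isGaussian_map
  refine Measure.ext_of_charFunDual (funext fun L => ?_)
  rw [hXI.charFunDual_map_eq_fun, hYI.charFunDual_map_eq_fun]
  obtain ⟨c, hL⟩ := exists_forall_eq_sum_mul L
  have hXm : ∀ i : I, MemLp (X i) 2 P := fun i => (hX.hasGaussianLaw_eval i).memLp_two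
  have hYm : ∀ i : I, MemLp (Y i) 2 P' := fun i => (hY.hasGaussianLaw_eval i).memLp_two
  simp only [hL, Finset.restrict]
  rw [integral_finsetSum _ fun i _ => ((hXm i).integrable (by norm_num)).const_mul _,
    integral_finsetSum _ fun i _ => ((hYm i).integrable (by norm_num)).const_mul _,
    ← covariance_self (Finset.aemeasurable_fun_sum _ fun i _ => (hXm i).aemeasurable.const_mul _), ← covariance_self (Finset.aemeasurable_fun_sum _ fun i _ => (hYm i).aemeasurable.const_mul _),
    covariance_fun_sum_fun_sum (fun i => (hXm i).const_mul _) (fun i => (hXm i).const_mul _),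
    covariance_fun_sum_fun_sum (fun i => (hYm i).const_mul _) (fun i => (hYm i).const_mul _)]
  simp only [covariance_const_mul_left, covariance_const_mul_right, integral_const_mul, hmean, hcov]

end Gaussian

lemma integral_indicator_Ioc_mul_indicator_Ioc (a b c d : ℝ) (x y : ℝ) :
    ∫ s, (Set.Ioc a b).indicator (fun _ => x) s * (Set.Ioc c d).indicator (fun _ => y) s
      = x * y * max (min b d - max a c) 0 := by
  have : (fun s => (Set.Ioc a b).indicator (fun _ => x) s * (Set.Ioc c d).indicator (fun _ => y) s)
      = (Set.Ioc (max a c) (min b d)).indicator fun _ => x * y := by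
    ext s
    rw [← Set.inter_indicator_mul, Set.Ioc_inter_Ioc]
  rw [this, integral_indicator measurableSet_Ioc, setIntegral_const, Real.volume_real_Ioc,
    smul_eq_mul, mul_comm]

lemma memLp_indicator_Ioc_const (a b x : ℝ) :
    MemLp ((Set.Ioc a b).indicator fun _ => x) 2 volume :=
  memLp_indicator_const 2 measurableSet_Ioc x (Or.inr measure_Ioc_lt_top.ne)

/-! ### Elementary integrals of step functions. -/

namespace StepFunction

variable {t : ℝ} (φ : StepFunction t)

lemma memLp_eval : MemLp φ.eval 2 volume :=
  memLp_finsetSum _ fun i _ => memLp_indicator_Ioc_const (φ.lo i) (φ.hi i) (φ.val i)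

lemma eval_eq_zero {s : ℝ} (hs : s ∉ Set.Ioc 0 t) : φ.eval s = 0 :=
  Finset.sum_eq_zero fun i _ => Set.indicator_of_notMem
    (fun h => hs ⟨(φ.lo i).2.trans_lt h.1, h.2.trans (φ.hi_le i)⟩) _

/-- Extending by zero puts integrands with different end points into the single space `L²(ℝ)`, where
the isometry can compare them. -/
lemma eLpNorm_eval_sub (f : ℝ → ℝ) :
    eLpNorm (fun s => φ.eval s - (Set.Ioc 0 t).indicator f s) 2 volume
      = eLpNorm (fun s => φ.eval s - f s) 2 (volume.restrict (Set.Ioc 0 t)) := by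
  rw [← eLpNorm_indicator_eq_eLpNorm_restrict measurableSet_Ioc]
  congr 1
  ext s
  by_cases hs : s ∈ Set.Ioc 0 t
  · simp [hs]
  · simp [hs, φ.eval_eq_zero hs]

variable {Ω : Type*} {mΩ : MeasurableSpace Ω} {P : Measure Ω} {B : ℝ≥0 → Ω → ℝ}

lemma isGaussianProcess_integral {ι : Type*} {τ : ι → ℝ} (ψ : ∀ i, StepFunction (τ i))
    (hB : IsGaussianProcess B P) : IsGaussianProcess (fun i => (ψ i).integral B) P := by
  classical
  refine hB.of_isGaussianProcess fun i => ?_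
  let J : Finset ℝ≥0 := Finset.univ.image (ψ i).lo ∪ Finset.univ.image (ψ i).hi
  have hlo : ∀ j, (ψ i).lo j ∈ J := by simp [J]
  have hhi : ∀ j, (ψ i).hi j ∈ J := by simp [J]
  refine ⟨J, ∑ j, (ψ i).val j • (ContinuousLinearMap.proj ⟨_, hhi j⟩
    - ContinuousLinearMap.proj (R := ℝ) (φ := fun _ : J => ℝ) ⟨_, hlo j⟩), fun ω => ?_⟩
  simp [StepFunction.integral]

lemma memLp_increment (hB : IsPreBrownianReal B P) (a b : ℝ≥0) :
    MemLp (fun ω => B a ω - B b ω) 2 P :=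
  (hB.isGaussianProcess.hasGaussianLaw_eval a).memLp_two.sub
    (hB.isGaussianProcess.hasGaussianLaw_eval b).memLp_two

lemma memLp_integral (hB : IsPreBrownianReal B P) :
    MemLp (φ.integral B) 2 P :=
  ((isGaussianProcess_integral (fun _ : Unit => φ)
    hB.isGaussianProcess).hasGaussianLaw_eval ()).memLp_two

variable [IsProbabilityMeasure P]

lemma integral_integral (hB : IsPreBrownianReal B P) : P[φ.integral B] = 0 := by
  have h : ∀ a b : ℝ≥0, P[fun ω => B a ω - B b ω] = 0 := fun a b => by
    rw [integral_sub (hB.integrable_eval a) (hB.integrable_eval b), hB.integral_eval,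
      hB.integral_eval, sub_zero]
  unfold StepFunction.integral
  rw [integral_finsetSum _ fun i _ =>
    ((memLp_increment hB _ _).integrable (by norm_num)).const_mul _]
  simp only [integral_const_mul, h, mul_zero, Finset.sum_const_zero]

/-- The Itô isometry for step functions. -/
lemma covariance_integral (hB : IsPreBrownianReal B P) {t' : ℝ} (ψ : StepFunction t') :
    cov[φ.integral B, ψ.integral B; P] = ∫ s, φ.eval s * ψ.eval s := by
  unfold StepFunction.integral StepFunction.eval
  rw [covariance_fun_sum_fun_sum (fun i => (memLp_increment hB _ _).const_mul _)
    (fun i => (memLp_increment hB _ _).const_mul _)]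
  simp_rw [Finset.sum_mul_sum]
  have hint : ∀ i j, Integrable (fun s =>
      (Set.Ioc (φ.lo i : ℝ) (φ.hi i)).indicator (fun _ => φ.val i) s *
      (Set.Ioc (ψ.lo j : ℝ) (ψ.hi j)).indicator (fun _ => ψ.val j) s) := fun i j =>
    (memLp_indicator_Ioc_const _ _ _).integrable_mul (memLp_indicator_Ioc_const _ _ _)
  rw [integral_finsetSum _ fun i _ => integrable_finsetSum _ fun j _ => hint i j]
  refine Finset.sum_congr rfl fun i _ => ?_
  rw [integral_finsetSum _ fun j _ => hint i j]
  refine Finset.sum_congr rfl fun j _ => ?_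
  have hm : ∀ a, MemLp (B a) 2 P := fun a =>
    (hB.isGaussianProcess.hasGaussianLaw_eval a).memLp_two
  rw [covariance_const_mul_left, covariance_const_mul_right,
    covariance_fun_sub_fun_sub (hm _) (hm _) (hm _) (hm _),
    integral_indicator_Ioc_mul_indicator_Ioc, mul_assoc]
  simp only [hB.covariance_eval, NNReal.coe_min]
  congr 2
  -- For correctly ordered end points, the alternating sum of four minima is the length of the
  -- overlap of the two intervals.
  have h1 : (φ.lo i : ℝ) ≤ φ.hi i := φ.lo_le_hi i
  have h2 : (ψ.lo j : ℝ) ≤ ψ.hi j := ψ.lo_le_hi j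
  grind

end StepFunction

/-! ### Wiener integrals: Gaussianity, mean and isometry. -/

section WienerIntegral

variable {Ω : Type*} {mΩ : MeasurableSpace Ω} {P : Measure Ω} [IsProbabilityMeasure P]
  {B : ℝ≥0 → Ω → ℝ} {ι : Type*} {τ : ι → ℝ} {f : ι → ℝ → ℝ} {V : ι → Ω → ℝ}

/-- Wiener integrals with respect to the same Wiener process form a Gaussian process. -/
lemma isGaussianProcess_of_isWienerIntegral (hB : IsPreBrownianReal B P)
    (hV : ∀ i, AEMeasurable (V i) P) (h : ∀ i, IsWienerIntegral B P (f i) (τ i) (V i)) :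
    IsGaussianProcess V P := by
  choose φ _ hφ using h
  exact isGaussianProcess_of_tendsto_eLpNorm
    (fun k => StepFunction.isGaussianProcess_integral (fun i => φ i k) hB.isGaussianProcess) hV hφ

lemma IsWienerIntegral.integral_eq_zero (hB : IsPreBrownianReal B P) {g : ℝ → ℝ} {t : ℝ}
    {X : Ω → ℝ} (hX : AEMeasurable X P) (h : IsWienerIntegral B P g t X) : P[X] = 0 := by
  obtain ⟨φ, -, hφ⟩ := h
  have hm := fun k => (φ k).memLp_integral hB
  refine tendsto_nhds_unique (tendsto_integral_of_tendsto_eLpNorm hm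
    (memLp_two_of_tendsto hm hX.aestronglyMeasurable hφ) hφ) ?_
  simp only [StepFunction.integral_integral _ hB]
  exact tendsto_const_nhds

/-- The Itô isometry for Wiener integrals. -/
lemma IsWienerIntegral.covariance_eq (hB : IsPreBrownianReal B P) {g g' : ℝ → ℝ} {t t' : ℝ}
    {X X' : Ω → ℝ} (hX : AEMeasurable X P) (hX' : AEMeasurable X' P)
    (hg : AEStronglyMeasurable g (volume.restrict (Set.Ioc 0 t)))
    (hg' : AEStronglyMeasurable g' (volume.restrict (Set.Ioc 0 t')))
    (h : IsWienerIntegral B P g t X) (h' : IsWienerIntegral B P g' t' X') :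
    cov[X, X'; P] = ∫ s in Set.Ioc 0 (min t t'), g s * g' s := by
  obtain ⟨φ, hφ, hφX⟩ := h
  obtain ⟨ψ, hψ, hψX⟩ := h'
  simp only [← StepFunction.eLpNorm_eval_sub] at hφ hψ
  have hm := fun k => (φ k).memLp_integral hB
  have hm' := fun k => (ψ k).memLp_integral hB
  have hG := memLp_two_of_tendsto (fun k => (φ k).memLp_eval)
    ((aestronglyMeasurable_indicator_iff measurableSet_Ioc).2 hg) hφ
  have hG' := memLp_two_of_tendsto (fun k => (ψ k).memLp_eval)
    ((aestronglyMeasurable_indicator_iff measurableSet_Ioc).2 hg') hψ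
  have h1 := tendsto_covariance_of_tendsto_eLpNorm hm hm'
    (memLp_two_of_tendsto hm hX.aestronglyMeasurable hφX)
    (memLp_two_of_tendsto hm' hX'.aestronglyMeasurable hψX) hφX hψX
  simp only [StepFunction.covariance_integral _ hB] at h1
  rw [tendsto_nhds_unique h1 (tendsto_integral_mul_of_tendsto_eLpNorm
    (fun k => (φ k).memLp_eval) (fun k => (ψ k).memLp_eval) hG hG' hφ hψ),
    ← integral_indicator measurableSet_Ioc]
  congr 1
  ext s
  rw [← Set.inter_indicator_mul, Set.Ioc_inter_Ioc, max_self]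

end WienerIntegral

/-! ### Covariance of the bridge. -/

section Covariance

/-- The function `t ↦ ∫ₜᵀ exp(-2 q̄(u)) σ(u)² du`, which equals `exp(-2 q̄(T)) γ(t,T)`. -/
def backVar (q σ : ℝ → ℝ) (T t : ℝ) : ℝ :=
  ∫ u in t..T, (Real.exp (qbar q u))⁻¹ ^ 2 * σ u ^ 2

/-- The covariance `Cov(U_s, U_t)` of the bridge over `[0, T]`, for `s ≤ t`. -/
def bridgeCov (q σ : ℝ → ℝ) (T s t : ℝ) : ℝ :=
  Real.exp (qbar q s) * Real.exp (qbar q t) * backVar q σ T t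
    * (backVar q σ T 0 - backVar q σ T s) / backVar q σ T 0

/-- The integrand in the integral representation of the bridge. -/
def bridgeKernel (q σ : ℝ → ℝ) (T t s : ℝ) : ℝ :=
  gam q σ t T / gam q σ s T * Real.exp (qbar q t - qbar q s) * σ s

variable {q σ : ℝ → ℝ} {T : ℝ}

lemma qbar_zero : qbar q 0 = 0 := intervalIntegral.integral_same

lemma backVar_self : backVar q σ T T = 0 := intervalIntegral.integral_same

lemma gam_eq_mul_backVar (t : ℝ) :
    gam q σ t T = Real.exp (qbar q T) ^ 2 * backVar q σ T t := by
  unfold gam backVar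
  rw [← intervalIntegral.integral_const_mul]
  congr 1
  ext u
  rw [← Real.exp_neg, ← mul_assoc, ← mul_pow, ← Real.exp_add, ← Real.exp_nat_mul]
  push_cast
  ring_nf

/-- The factor `exp(2 q̄(T))` cancels in the quotient of the two `gam`, which separates the
variables `t` and `s`. -/
lemma bridgeKernel_eq (t s : ℝ) : bridgeKernel q σ T t s
    = backVar q σ T t * Real.exp (qbar q t) *
      ((backVar q σ T s)⁻¹ * (Real.exp (qbar q s))⁻¹ * σ s) := by
  unfold bridgeKernel
  rw [gam_eq_mul_backVar, gam_eq_mul_backVar, mul_div_mul_left _ _ (by positivity), Real.exp_sub]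
  ring

lemma hasDerivAt_exp_qbar (hq : Continuous q) (t : ℝ) :
    HasDerivAt (fun t => Real.exp (qbar q t)) (Real.exp (qbar q t) * q t) t :=
  (intervalIntegral.integral_hasDerivAt_right (hq.intervalIntegrable _ _)
    hq.stronglyMeasurable.stronglyMeasurableAtFilter hq.continuousAt).exp

lemma continuous_exp_qbar (hq : Continuous q) : Continuous fun t => Real.exp (qbar q t) :=
  continuous_iff_continuousAt.2 fun t => (hasDerivAt_exp_qbar hq t).continuousAt

lemma continuous_backVar_integrand (hq : Continuous q) (hσ : Continuous σ) :
    Continuous fun u => (Real.exp (qbar q u))⁻¹ ^ 2 * σ u ^ 2 :=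
  (((continuous_exp_qbar hq).inv₀ fun _ => (Real.exp_pos _).ne').pow 2).mul (hσ.pow 2)

lemma hasDerivAt_backVar (hq : Continuous q) (hσ : Continuous σ) (t : ℝ) :
    HasDerivAt (backVar q σ T) (-((Real.exp (qbar q t))⁻¹ ^ 2 * σ t ^ 2)) t :=
  have h := continuous_backVar_integrand hq hσ
  intervalIntegral.integral_hasDerivAt_left (h.intervalIntegrable _ _)
    h.stronglyMeasurable.stronglyMeasurableAtFilter h.continuousAt

lemma continuous_backVar (hq : Continuous q) (hσ : Continuous σ) : Continuous (backVar q σ T) :=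
  continuous_iff_continuousAt.2 fun t => (hasDerivAt_backVar hq hσ t).continuousAt

lemma backVar_pos (hq : Continuous q) (hσ : Continuous σ) (hσ0 : ∀ t, σ t ≠ 0) {t : ℝ}
    (ht : t < T) : 0 < backVar q σ T t :=
  intervalIntegral.intervalIntegral_pos_of_pos
    ((continuous_backVar_integrand hq hσ).intervalIntegrable _ _)
    (fun u => by have := hσ0 u; positivity) ht

lemma measurable_bridgeKernel (hq : Continuous q) (hσ : Continuous σ) (t : ℝ) :
    Measurable (bridgeKernel q σ T t) := by
  have h1 := (continuous_exp_qbar hq).measurable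
  have h2 := (continuous_backVar (T := T) hq hσ).measurable
  have h3 := hσ.measurable
  rw [funext (bridgeKernel_eq (q := q) (σ := σ) (T := T) t)]
  fun_prop

/-- The covariance of the bridge, computed from its integral representation. -/
lemma setIntegral_bridgeKernel_mul (hq : Continuous q) (hσ : Continuous σ) (hσ0 : ∀ t, σ t ≠ 0)
    {s t : ℝ} (hs : 0 ≤ s) (hst : s ≤ t) (ht : t ≤ T) :
    ∫ u in Set.Ioc 0 s, bridgeKernel q σ T s u * bridgeKernel q σ T t u = bridgeCov q σ T s t := by
  simp only [bridgeKernel_eq]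
  rcases (hst.trans ht).lt_or_eq with hsT | rfl
  · have hF : ∀ u ∈ Set.uIcc 0 s, HasDerivAt (fun u => (backVar q σ T u)⁻¹)
        (((backVar q σ T u)⁻¹ * (Real.exp (qbar q u))⁻¹ * σ u) ^ 2) u := by
      intro u hu
      rw [Set.uIcc_of_le hs] at hu
      have hpos := backVar_pos hq hσ hσ0 (hu.2.trans_lt hsT)
      refine ((hasDerivAt_backVar (T := T) hq hσ u).inv hpos.ne').congr_deriv ?_
      ring
    have hcont : ContinuousOn
        (fun u => ((backVar q σ T u)⁻¹ * (Real.exp (qbar q u))⁻¹ * σ u) ^ 2) (Set.uIcc 0 s) := by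
      refine ((ContinuousOn.mul (ContinuousOn.inv₀ (continuous_backVar hq hσ).continuousOn ?_)
        ((continuous_exp_qbar hq).inv₀ fun _ => (Real.exp_pos _).ne').continuousOn).mul
        hσ.continuousOn).pow 2
      intro u hu
      rw [Set.uIcc_of_le hs] at hu
      exact (backVar_pos hq hσ hσ0 (hu.2.trans_lt hsT)).ne'
    have hI := intervalIntegral.integral_eq_sub_of_hasDerivAt hF hcont.intervalIntegrable
    rw [intervalIntegral.integral_of_le hs] at hI
    have h0 := backVar_pos hq hσ hσ0 (hs.trans_lt hsT)
    have h1 := backVar_pos hq hσ hσ0 hsT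
    calc _ = ∫ u in Set.Ioc 0 s, (backVar q σ T s * Real.exp (qbar q s) * backVar q σ T t
          * Real.exp (qbar q t)) * ((backVar q σ T u)⁻¹ * (Real.exp (qbar q u))⁻¹ * σ u) ^ 2 := by
            congr 1; ext u; ring
      _ = _ := by
        rw [integral_const_mul, hI, bridgeCov]
        field_simp
  -- At the terminal time both kernels vanish, because `backVar` is zero there.
  · obtain rfl : s = t := le_antisymm hst ht
    simp [bridgeCov, backVar_self]

end Covariance

/-! ### Solving the covariance identity for `q` and `σ²`. -/

section Characterization

variable {q σ : ℝ → ℝ} {T : ℝ}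

lemma exp_qbar_of_eq_div {c : ℝ} (hc : 0 < 1 + c * T)
    (h : ∀ t ∈ Set.Icc 0 T, q t = c / (1 + c * t)) {t : ℝ} (ht : t ∈ Set.Icc 0 T) :
    Real.exp (qbar q t) = 1 + c * t := by
  have hpos : ∀ u ∈ Set.Icc 0 T, 0 < 1 + c * u := by
    intro u hu
    rcases le_total 0 c with h0 | h0
    · nlinarith [hu.1, mul_nonneg h0 hu.1]
    · nlinarith [mul_le_mul_of_nonpos_left hu.2 h0]
  have hsub : Set.uIcc 0 t ⊆ Set.Icc 0 T := by
    rw [Set.uIcc_of_le ht.1]; exact Set.Icc_subset_Icc_right ht.2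
  have hder : ∀ u ∈ Set.uIcc 0 t, HasDerivAt (fun u => Real.log (1 + c * u)) (c / (1 + c * u)) u := by
    intro u hu
    have := ((hasDerivAt_id u).const_mul c).const_add 1
    simp only [id, mul_one] at this
    exact this.log (hpos u (hsub hu)).ne'
  have hint : qbar q t = Real.log (1 + c * t) := by
    unfold qbar
    rw [intervalIntegral.integral_congr fun u hu => h u (hsub hu),
      intervalIntegral.integral_eq_sub_of_hasDerivAt hder]
    · simp
    · refine ContinuousOn.intervalIntegrable (ContinuousOn.div continuousOn_const (by fun_prop) ?_)
      exact fun u hu => (hpos u (hsub hu)).ne'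
  rw [hint, Real.exp_log (hpos t ht)]

lemma backVar_of_eq_div {c : ℝ} (hc : 0 < 1 + c * T)
    (h : ∀ t ∈ Set.Icc 0 T, q t = c / (1 + c * t)) (hσ : ∀ t ∈ Set.Icc 0 T, σ t ^ 2 = 1)
    {t : ℝ} (ht : t ∈ Set.Icc 0 T) :
    backVar q σ T t = (T - t) / ((1 + c * t) * (1 + c * T)) := by
  have hpos : ∀ u ∈ Set.Icc 0 T, 0 < 1 + c * u := fun u hu =>
    exp_qbar_of_eq_div hc h hu ▸ Real.exp_pos _
  have hsub : Set.uIcc t T ⊆ Set.Icc 0 T := by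
    rw [Set.uIcc_of_le ht.2]; exact Set.Icc_subset_Icc_left ht.1
  -- This is the antiderivative of `(1 + c u)⁻²` that vanishes at `T`; the check uses `(1 + c u) + c
  -- (T - u) = 1 + c T`.
  have hder : ∀ u ∈ Set.uIcc t T, HasDerivAt (fun u => -((T - u) / (1 + c * u) / (1 + c * T)))
      ((1 + c * u)⁻¹ ^ 2) u := by
    intro u hu
    have h1 : HasDerivAt (fun u => 1 + c * u) c u := by
      simpa using ((hasDerivAt_id u).const_mul c).const_add 1
    have h2 : HasDerivAt (fun u => T - u) (-1) u := (hasDerivAt_id u).const_sub T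
    have hu0 := hpos u (hsub hu)
    refine ((h2.div h1 hu0.ne').div_const (1 + c * T)).neg.congr_deriv ?_
    field_simp
    ring
  unfold backVar
  rw [intervalIntegral.integral_congr (g := fun u => (1 + c * u)⁻¹ ^ 2),
    intervalIntegral.integral_eq_sub_of_hasDerivAt hder]
  · have := hpos t ht
    simp [div_div]
  · refine ContinuousOn.intervalIntegrable ((ContinuousOn.inv₀ (by fun_prop) ?_).pow 2)
    exact fun u hu => (hpos u (hsub hu)).ne'
  · intro u hu
    simp only [exp_qbar_of_eq_div hc h (hsub hu), hσ u (hsub hu), mul_one]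

lemma bridgeCov_of_eq_div (hT : 0 < T) {c : ℝ} (hc : 0 < 1 + c * T)
    (h : ∀ t ∈ Set.Icc 0 T, q t = c / (1 + c * t)) (hσ : ∀ t ∈ Set.Icc 0 T, σ t ^ 2 = 1)
    {s t : ℝ} (hs : s ∈ Set.Icc 0 T) (ht : t ∈ Set.Icc 0 T) :
    bridgeCov q σ T s t = s * (T - t) / T := by
  have hpos : ∀ u ∈ Set.Icc 0 T, 0 < 1 + c * u := fun u hu =>
    exp_qbar_of_eq_div hc h hu ▸ Real.exp_pos _
  have hs' := hpos s hs
  have ht' := hpos t ht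
  unfold bridgeCov
  rw [exp_qbar_of_eq_div hc h hs, exp_qbar_of_eq_div hc h ht,
    backVar_of_eq_div hc h hσ hs, backVar_of_eq_div hc h hσ ht,
    backVar_of_eq_div hc h hσ ⟨le_rfl, hT.le⟩]
  simp only [mul_zero, add_zero, sub_zero, one_mul]
  field_simp
  ring

/-- If the bridge has the covariance function of the Wiener bridge, then `exp q̄` is affine. -/
lemma exists_exp_qbar_eq_of_bridgeCov_eq (hT : 0 < T) (hq : Continuous q) (hσ : Continuous σ)
    (hσ0 : ∀ t, σ t ≠ 0)
    (h : ∀ s t, 0 ≤ s → s ≤ t → t ≤ T → bridgeCov q σ T s t = s * (T - t) / T) :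
    ∃ κ : ℝ, 0 < κ ∧ ∀ t ∈ Set.Ioo 0 T,
      Real.exp (qbar q t) * backVar q σ T t = κ * (T - t) ∧
      Real.exp (qbar q t) = 1 + (1 - κ) / (κ * T) * t := by
  set A : ℝ → ℝ := fun t => Real.exp (qbar q t) with hA
  set H : ℝ → ℝ := backVar q σ T with hH
  have hA0 : A 0 = 1 := by simp [hA, qbar_zero]
  have hH0 : 0 < H 0 := backVar_pos hq hσ hσ0 hT
  have hApos : ∀ t, 0 < A t := fun t => Real.exp_pos _
  have hHpos : ∀ t, t < T → 0 < H t := fun t ht => backVar_pos hq hσ hσ0 ht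
  have hprod : ∀ s t, 0 ≤ s → s ≤ t → t ≤ T →
      (A s * (H 0 - H s)) * (A t * H t) = H 0 / T * (s * (T - t)) := by
    intro s t h0 h1 h2
    have : A s * A t * H t * (H 0 - H s) / H 0 = s * (T - t) / T := h s t h0 h1 h2
    field_simp at this ⊢
    linear_combination this
  have hκ : 0 < H 0 / T := div_pos hH0 hT
  set κ := H 0 / T with hκdef
  have hκT : κ * T = H 0 := by rw [hκdef]; field_simp
  -- Any interior point would do: fixing `t = r` gives the `s`-factor on `[0, r]`. The `t`-factor
  -- then follows from the diagonal on `(0, r]`, and from `s = r` on `[r, T)`.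
  set r := T / 2 with hr
  have hr0 : 0 < r := by positivity
  have hrT : r < T := by linarith
  have hYr : 0 < A r * H r := mul_pos (hApos r) (hHpos r hrT)
  set m := κ * (T - r) / (A r * H r) with hm
  have hXlow : ∀ s, 0 ≤ s → s ≤ r → A s * (H 0 - H s) = m * s := by
    intro s h0 h1
    have := hprod s r h0 h1 hrT.le
    rw [hm, div_mul_eq_mul_div, eq_div_iff hYr.ne']
    linear_combination this
  have hY : ∀ t ∈ Set.Ioo 0 T, m * (A t * H t) = κ * (T - t) := by
    intro t ht
    rcases le_total t r with htr | htr
    · have h1 := hprod t t ht.1.le le_rfl ht.2.le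
      rw [hXlow t ht.1.le htr] at h1
      refine mul_left_cancel₀ ht.1.ne' ?_
      linear_combination h1
    · have h1 := hprod r t hr0.le htr ht.2.le
      rw [hXlow r hr0.le le_rfl] at h1
      refine mul_left_cancel₀ hr0.ne' ?_
      linear_combination h1
  have hcA : Continuous A := continuous_exp_qbar hq
  have hcH : Continuous H := continuous_backVar hq hσ
  -- The separation constant is read off at `t = 0`, where `A = 1` and `κ T = H 0`. The identity
  -- there comes from continuity, since its derivation divided by `t`.
  have hm1 : m = 1 := by
    have heq : Set.EqOn (fun t => m * (A t * H t)) (fun t => κ * (T - t)) (Set.Icc 0 T) := by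
      rw [← closure_Ioo hT.ne]
      exact Set.EqOn.closure hY (by fun_prop) (by fun_prop)
    have h1 := heq (Set.left_mem_Icc.2 hT.le)
    simp only [hA0, sub_zero, one_mul, hκT] at h1
    exact mul_right_cancel₀ hH0.ne' (h1.trans (one_mul _).symm)
  rw [hm1] at hY
  refine ⟨κ, hκ, fun t ht => ?_⟩
  have h1 : A t * H t = κ * (T - t) := by simpa using hY t ht
  refine ⟨h1, ?_⟩
  have h2 := hprod t t ht.1.le le_rfl ht.2.le
  rw [h1] at h2
  have h3 : A t * (H 0 - H t) = t := by
    have hTt : T - t ≠ 0 := by linarith [ht.2]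
    have : κ * (T - t) ≠ 0 := mul_ne_zero hκ.ne' hTt
    refine mul_right_cancel₀ this ?_
    linear_combination h2
  have h4 : A t * (κ * T) = t + κ * (T - t) := by
    rw [hκT]; linear_combination h1 + h3
  change A t = _
  field_simp
  linear_combination h4

lemma eq_div_of_bridgeCov_eq (hT : 0 < T) (hq : Continuous q) (hσ : Continuous σ)
    (hσ0 : ∀ t, σ t ≠ 0)
    (h : ∀ s t, 0 ≤ s → s ≤ t → t ≤ T → bridgeCov q σ T s t = s * (T - t) / T) :
    ∃ c : ℝ, 0 < 1 + c * T ∧ (∀ t ∈ Set.Icc 0 T, q t * (1 + c * t) = c) ∧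
      ∀ t ∈ Set.Icc 0 T, σ t ^ 2 = 1 := by
  obtain ⟨κ, hκ, hκ'⟩ := exists_exp_qbar_eq_of_bridgeCov_eq hT hq hσ hσ0 h
  set c := (1 - κ) / (κ * T) with hc
  have hκc : κ * (1 + c * T) = 1 := by rw [hc]; field_simp; ring
  have hqc : ∀ t ∈ Set.Ioo 0 T, q t * (1 + c * t) = c := by
    intro t ht
    have h1 : (fun t => Real.exp (qbar q t)) =ᶠ[𝓝 t] fun t => 1 + c * t :=
      eventually_of_mem (Ioo_mem_nhds ht.1 ht.2) fun u hu => (hκ' u hu).2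
    have h2 : HasDerivAt (fun u => 1 + c * u) c t := by
      simpa using ((hasDerivAt_id t).const_mul c).const_add 1
    have h3 := ((hasDerivAt_exp_qbar hq t).congr_of_eventuallyEq h1.symm).unique h2
    rw [(hκ' t ht).2] at h3
    linear_combination h3
  have hσc : ∀ t ∈ Set.Ioo 0 T, σ t ^ 2 = 1 := by
    intro t ht
    have h1 : (fun t => Real.exp (qbar q t) * backVar q σ T t) =ᶠ[𝓝 t] fun t => κ * (T - t) :=
      eventually_of_mem (Ioo_mem_nhds ht.1 ht.2) fun u hu => (hκ' u hu).1
    have h2 : HasDerivAt (fun u => κ * (T - u)) (-κ) t := by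
      simpa using ((hasDerivAt_id t).const_sub T).const_mul κ
    have h3 := (((hasDerivAt_exp_qbar hq t).mul
      (hasDerivAt_backVar (T := T) hq hσ t)).congr_of_eventuallyEq h1.symm).unique h2
    have h4 := (hκ' t ht).1
    have h5 := (hκ' t ht).2
    have h6 := hqc t ht
    have hpos := Real.exp_pos (qbar q t)
    rw [← h5] at h6
    field_simp at h3
    -- Since `A q = c`, the derivative of `A H = κ (T - t)` reads `c H - σ²/A = -κ`. Substituting `A
    -- H` and `A` turns the right-hand side here into `κ (1 + c T) = 1`.
    have h7 : σ t ^ 2 = c * (Real.exp (qbar q t) * backVar q σ T t) + κ * Real.exp (qbar q t) := by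
      linear_combination -h3 + Real.exp (qbar q t) * backVar q σ T t * h6
    rw [h4, h5] at h7
    linear_combination h7 + hκc
  refine ⟨c, by_contra fun hneg => ?_, ?_, ?_⟩
  · nlinarith
  · rw [← closure_Ioo hT.ne]
    exact Set.EqOn.closure (f := fun t => q t * (1 + c * t)) (g := fun _ => c) hqc
      (by fun_prop) continuous_const
  · rw [← closure_Ioo hT.ne]
    exact Set.EqOn.closure (f := fun t => σ t ^ 2) (g := fun _ => 1) hσc
      (by fun_prop) continuous_const

end Characterization

/-! ### Finite-dimensional distributions and laws. -/

section SameFDD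

variable {ι Ω Ω' Ω'' : Type*} {mΩ : MeasurableSpace Ω} {mΩ' : MeasurableSpace Ω'}
  {mΩ'' : MeasurableSpace Ω''} {P : Measure Ω} {P' : Measure Ω'} {P'' : Measure Ω''}
  {X : ι → Ω → ℝ} {Y : ι → Ω' → ℝ} {Z : ι → Ω'' → ℝ}

lemma SameFDD.symm (h : SameFDD P P' X Y) : SameFDD P' P Y X := fun I => (h I).symm

lemma SameFDD.trans (h : SameFDD P P' X Y) (h' : SameFDD P' P'' Y Z) : SameFDD P P'' X Z :=
  fun I => (h I).trans (h' I)

lemma SameFDD.covariance_eq (h : SameFDD P P' X Y) (i j : ι) :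
    cov[X i, X j; P] = cov[Y i, Y j; P'] := by
  classical
  have hi : i ∈ ({i, j} : Finset ι) := by simp
  have hj : j ∈ ({i, j} : Finset ι) := by simp
  have hm : ∀ k ∈ ({i, j} : Finset ι), P[X k] = P'[Y k] := by
    intro k hk
    have := ((h {i, j}).comp (u := fun x => x ⟨k, hk⟩) (by fun_prop)).integral_eq
    exact this
  have := ((h {i, j}).comp (u := fun x => (x ⟨i, hi⟩ - P[X i]) * (x ⟨j, hj⟩ - P[X j]))
    (by fun_prop)).integral_eq
  rw [covariance, covariance, ← hm i hi, ← hm j hj]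
  exact this

lemma sameFDD_of_identDistrib (h : IdentDistrib (fun ω i => X i ω) (fun ω i => Y i ω) P P') :
    SameFDD P P' X Y := fun I => h.comp (Finset.measurable_restrict I)

/-- Each law on the product space is the projective limit of its finite-dimensional marginals, and
such a limit is unique. -/
lemma SameFDD.identDistrib [IsFiniteMeasure P] (hX : ∀ i, Measurable (X i))
    (hY : ∀ i, Measurable (Y i)) (h : SameFDD P P' X Y) :
    IdentDistrib (fun ω i => X i ω) (fun ω i => Y i ω) P P' := by
  have hX' : AEMeasurable (fun ω i => X i ω) P := (measurable_pi_lambda _ hX).aemeasurable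
  have hY' : AEMeasurable (fun ω i => Y i ω) P' := (measurable_pi_lambda _ hY).aemeasurable
  refine ⟨hX', hY', (isProjectiveLimit_map hX').unique ?_⟩
  simpa only [(h _).map_eq] using isProjectiveLimit_map hY'

end SameFDD

lemma IsWienerIntegral.congr {Ω : Type*} {mΩ : MeasurableSpace Ω} {P : Measure Ω}
    {B : ℝ≥0 → Ω → ℝ} {f g : ℝ → ℝ} {t : ℝ} {J J' : Ω → ℝ} (h : IsWienerIntegral B P f t J)
    (hfg : Set.EqOn f g (Set.Ioc 0 t)) (hJ : J =ᵐ[P] J') : IsWienerIntegral B P g t J' := by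
  obtain ⟨φ, h1, h2⟩ := h
  refine ⟨φ, h1.congr fun k => eLpNorm_congr_ae ?_, h2.congr fun k => eLpNorm_congr_ae ?_⟩
  · filter_upwards [ae_restrict_mem measurableSet_Ioc] with s hs
    rw [hfg hs]
  · filter_upwards [hJ] with ω hω
    rw [hω]

lemma isWienerIntegral_zero {Ω : Type*} {mΩ : MeasurableSpace Ω} {P : Measure Ω}
    (B : ℝ≥0 → Ω → ℝ) (t : ℝ) : IsWienerIntegral B P (fun _ => 0) t (fun _ => 0) := by
  let φ : StepFunction t :=
    { n := 0
      lo := Fin.elim0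
      hi := Fin.elim0
      val := Fin.elim0
      lo_le_hi := fun i => i.elim0
      hi_le := fun i => i.elim0 }
  refine ⟨fun _ => φ, ?_, ?_⟩
  · simp [StepFunction.eval, φ]
  · simp [StepFunction.integral, φ]

/-! ### Extending the coefficients to `ℝ`, so that two-sided derivatives exist at `0`; the bridge
only sees times `≥ 0`. -/

section Extension

/-- The continuous extension to `ℝ` of a function on `[0, ∞)`, constant on `(-∞, 0]`. -/
def constExt (f : ℝ → ℝ) (t : ℝ) : ℝ := f (max t 0)

variable {f q σ : ℝ → ℝ} {T : ℝ}

lemma constExt_of_nonneg {t : ℝ} (ht : 0 ≤ t) : constExt f t = f t := by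
  rw [constExt, max_eq_left ht]

lemma continuous_constExt (hf : ContinuousOn f (Set.Ici 0)) : Continuous (constExt f) :=
  hf.comp_continuous (by fun_prop) fun t => le_max_right t 0

lemma qbar_constExt {t : ℝ} (ht : 0 ≤ t) : qbar (constExt q) t = qbar q t := by
  refine intervalIntegral.integral_congr fun u hu => constExt_of_nonneg ?_
  rw [Set.uIcc_of_le ht] at hu
  exact hu.1

lemma gam_constExt {s t : ℝ} (hs : 0 ≤ s) (ht : 0 ≤ t) :
    gam (constExt q) (constExt σ) s t = gam q σ s t := by
  refine intervalIntegral.integral_congr fun u hu => ?_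
  have hu0 : 0 ≤ u := (le_min hs ht).trans hu.1
  simp only [qbar_constExt ht, qbar_constExt hu0, constExt_of_nonneg hu0]

lemma bridgeKernel_constExt (hT : 0 ≤ T) {s t : ℝ} (hs : 0 ≤ s) (ht : 0 ≤ t) :
    bridgeKernel (constExt q) (constExt σ) T t s = bridgeKernel q σ T t s := by
  simp only [bridgeKernel, gam_constExt ht hT, gam_constExt hs hT, qbar_constExt hs,
    qbar_constExt ht, constExt_of_nonneg hs]

end Extension

/-! ### The bridges as centred Gaussian processes. -/

section Bridge

variable {Ω : Type*} {mΩ : MeasurableSpace Ω} {P : Measure Ω} {B : ℝ≥0 → Ω → ℝ}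
  {q σ : ℝ → ℝ} {T : ℝ} {V : Set.Icc (0 : ℝ) T → Ω → ℝ}

/-- The terminal condition joins the integral representation: at `t = T` the kernel is zero, hence
so is its integral. No separate treatment of `T` is needed afterwards. -/
lemma IsIntegralOUBridge.isWienerIntegral (hV : IsIntegralOUBridge P B q σ T 0 0 V)
    (t : Set.Icc (0 : ℝ) T) :
    IsWienerIntegral B P (bridgeKernel (constExt q) (constExt σ) T t) t (V t) := by
  have hT : 0 ≤ T := t.2.1.trans t.2.2
  rcases t.2.2.lt_or_eq with ht | ht
  · refine (hV.integral_rep t ht).congr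
      (fun s hs => (bridgeKernel_constExt hT hs.1.le t.2.1).symm) (ae_of_all _ fun ω => ?_)
    simp [bridgeMean]
  · refine (isWienerIntegral_zero B t).congr (fun s _ => ?_) ?_
    · simp [bridgeKernel_eq, ht, backVar_self]
    · filter_upwards [hV.terminal t ht] with ω hω
      rw [hω]

/-- The Wiener bridge is the bridge derived from the Wiener process. -/
lemma IsIntegralWienerBridge.isIntegralOUBridge (hV : IsIntegralWienerBridge P B T 0 0 V) :
    IsIntegralOUBridge P B (fun _ => 0) (fun _ => 1) T 0 0 V where
  toIsContProcess := hV.toIsContProcess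
  integral_rep t ht := by
    simpa [gam, qbar, bridgeMean] using hV.integral_rep t ht
  terminal := hV.terminal

variable [IsProbabilityMeasure P]

lemma IsIntegralOUBridge.isGaussianProcess (hV : IsIntegralOUBridge P B q σ T 0 0 V)
    (hB : IsPreBrownianReal B P) : IsGaussianProcess V P :=
  isGaussianProcess_of_isWienerIntegral hB (fun t => (hV.measurable t).aemeasurable)
    hV.isWienerIntegral

lemma IsIntegralOUBridge.integral_eq_zero (hV : IsIntegralOUBridge P B q σ T 0 0 V)
    (hB : IsPreBrownianReal B P) (t : Set.Icc (0 : ℝ) T) : P[V t] = 0 :=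
  (hV.isWienerIntegral t).integral_eq_zero hB (hV.measurable t).aemeasurable

lemma IsIntegralOUBridge.covariance_eq (hV : IsIntegralOUBridge P B q σ T 0 0 V)
    (hB : IsPreBrownianReal B P) (hq : ContinuousOn q (Set.Ici 0))
    (hσ : ContinuousOn σ (Set.Ici 0)) (hσ0 : ∀ t, 0 ≤ t → σ t ≠ 0)
    {s t : Set.Icc (0 : ℝ) T} (hst : s ≤ t) :
    cov[V s, V t; P] = bridgeCov (constExt q) (constExt σ) T s t := by
  have hq' := continuous_constExt hq
  have hσ' := continuous_constExt hσ
  have hst' : (s : ℝ) ≤ t := hst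
  rw [(hV.isWienerIntegral s).covariance_eq hB (hV.measurable s).aemeasurable
    (hV.measurable t).aemeasurable
    (measurable_bridgeKernel hq' hσ' _).aestronglyMeasurable
    (measurable_bridgeKernel hq' hσ' _).aestronglyMeasurable (hV.isWienerIntegral t),
    min_eq_left hst', setIntegral_bridgeKernel_mul hq' hσ' (fun u => hσ0 _ (le_max_right u 0))
      s.2.1 hst' t.2.2]

lemma IsIntegralWienerBridge.covariance_eq (hV : IsIntegralWienerBridge P B T 0 0 V)
    (hB : IsPreBrownianReal B P) (hT : 0 < T) {s t : Set.Icc (0 : ℝ) T} (hst : s ≤ t) :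
    cov[V s, V t; P] = s * (T - t) / T := by
  rw [hV.isIntegralOUBridge.covariance_eq hB continuousOn_const continuousOn_const
    (fun _ _ => one_ne_zero) hst, bridgeCov_of_eq_div hT (c := 0) (by simp) _ _ s.2 t.2] <;>
  simp [constExt]

/-- The bridge derived from an Ornstein-Uhlenbeck type process is a Wiener bridge in law if and only
if it has the covariance function of the Wiener bridge. -/
lemma sameFDD_iff_bridgeCov_eq {Ω' : Type*} {mΩ' : MeasurableSpace Ω'} {P' : Measure Ω'}
    [IsProbabilityMeasure P'] {B' : ℝ≥0 → Ω' → ℝ} {W : Set.Icc (0 : ℝ) T → Ω' → ℝ}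
    (hB : IsPreBrownianReal B P) (hB' : IsPreBrownianReal B' P') (hT : 0 < T)
    (hq : ContinuousOn q (Set.Ici 0)) (hσ : ContinuousOn σ (Set.Ici 0))
    (hσ0 : ∀ t, 0 ≤ t → σ t ≠ 0) (hV : IsIntegralOUBridge P B q σ T 0 0 V)
    (hW : IsIntegralWienerBridge P' B' T 0 0 W) :
    SameFDD P P' V W ↔ ∀ s t, 0 ≤ s → s ≤ t → t ≤ T →
      bridgeCov (constExt q) (constExt σ) T s t = s * (T - t) / T := by
  constructor
  · intro h s t h0 hst htT
    have hst' : (⟨s, h0, hst.trans htT⟩ : Set.Icc (0 : ℝ) T) ≤ ⟨t, h0.trans hst, htT⟩ := hst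
    rw [← hV.covariance_eq hB hq hσ hσ0 hst', h.covariance_eq, hW.covariance_eq hB' hT hst']
  · intro h
    refine sameFDD_of_isGaussianProcess (hV.isGaussianProcess hB)
      (hW.isIntegralOUBridge.isGaussianProcess hB') (fun t => ?_) fun s t => ?_
    · rw [hV.integral_eq_zero hB, hW.isIntegralOUBridge.integral_eq_zero hB']
    · wlog hst : s ≤ t generalizing s t
      · rw [covariance_comm, this t s (le_of_not_ge hst), covariance_comm]
      · rw [hV.covariance_eq hB hq hσ hσ0 hst, hW.covariance_eq hB' hT hst,
          h s t s.2.1 hst t.2.2]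

end Bridge

/-! ### Translation between `c` and `C = 1/c`. -/

section Characterization

variable {q σ : ℝ → ℝ} {T : ℝ}

lemma one_add_mul_pos_of_notMem_Icc {C : ℝ} (hC : C ∉ Set.Icc (-T) 0) (hT : 0 < T) {t : ℝ}
    (ht : t ∈ Set.Icc 0 T) : 0 < 1 + C⁻¹ * t := by
  rcases lt_or_ge 0 C with h | h
  · have := mul_nonneg (inv_nonneg.2 h.le) ht.1
    linarith
  · have h1 : C < -T := by
      by_contra hlt
      exact hC ⟨not_lt.1 hlt, h⟩
    have h2 : C < 0 := by linarith
    have h3 : 1 + C⁻¹ * t = (C + t) / C := by rw [add_div, div_self h2.ne, inv_mul_eq_div]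
    rw [h3]
    exact div_pos_of_neg_of_neg (by linarith [ht.2]) h2

/-- A negative `c` with `c⁻¹ ≥ -T` would give `1 ≤ -c T`; strict positivity at `T` is what excludes
the end point `C = -T`. -/
lemma inv_notMem_Icc_of_one_add_mul_pos {c : ℝ} (hc0 : c ≠ 0) (hc : 0 < 1 + c * T) :
    c⁻¹ ∉ Set.Icc (-T) 0 := by
  rintro ⟨h1, h2⟩
  have h3 : c < 0 := lt_of_le_of_ne (inv_nonpos.1 h2) hc0
  have h4 := mul_le_mul_of_nonpos_left h1 h3.le
  rw [mul_inv_cancel₀ hc0] at h4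
  linarith

lemma bridgeCov_eq_iff (hT : 0 < T) (hq : ContinuousOn q (Set.Ici 0))
    (hσ : ContinuousOn σ (Set.Ici 0)) (hσ0 : ∀ t, 0 ≤ t → σ t ≠ 0) :
    (∀ s t, 0 ≤ s → s ≤ t → t ≤ T →
      bridgeCov (constExt q) (constExt σ) T s t = s * (T - t) / T) ↔
      ((∃ C : ℝ, C ∉ Set.Icc (-T) 0 ∧ ∀ t ∈ Set.Ico 0 T, q t = 1 / (t + C)) ∨
          (∀ t ∈ Set.Ico 0 T, q t = 0)) ∧
        ((∀ t ∈ Set.Ico 0 T, σ t = 1) ∨ (∀ t ∈ Set.Ico 0 T, σ t = -1)) := by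
  have hq' : ContinuousOn q (Set.Icc 0 T) := hq.mono Set.Icc_subset_Ici_self
  have hσ' : ContinuousOn σ (Set.Icc 0 T) := hσ.mono Set.Icc_subset_Ici_self
  constructor
  · intro h
    obtain ⟨c, hc, hqc, hσc⟩ := eq_div_of_bridgeCov_eq hT (continuous_constExt hq)
      (continuous_constExt hσ) (fun u => hσ0 _ (le_max_right u 0)) h
    have hqc' : ∀ t ∈ Set.Ico 0 T, q t * (1 + c * t) = c := fun t ht =>
      constExt_of_nonneg (f := q) ht.1 ▸ hqc t (Set.Ico_subset_Icc_self ht)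
    constructor
    · by_cases hc0 : c = 0
      · right
        intro t ht
        simpa [hc0] using hqc' t ht
      · left
        refine ⟨c⁻¹, inv_notMem_Icc_of_one_add_mul_pos hc0 hc, fun t ht => ?_⟩
        have h1 : t + c⁻¹ = (1 + c * t) / c := by field_simp; ring
        have h2 : 1 + c * t ≠ 0 := fun h0 => hc0 (by simpa [h0] using (hqc' t ht).symm)
        rw [h1, one_div_div, eq_div_iff h2, hqc' t ht]
    · have hsq : Set.EqOn (σ ^ 2) 1 (Set.Ico 0 T) := fun t ht => by
        have := hσc t (Set.Ico_subset_Icc_self ht)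
        rwa [constExt_of_nonneg ht.1] at this
      exact isPreconnected_Ico.eq_one_or_eq_neg_one_of_sq_eq
        (hσ'.mono Set.Ico_subset_Icc_self) hsq
  · rintro ⟨hqC, hσ1⟩
    obtain ⟨c, hc, hqc⟩ : ∃ c : ℝ, (∀ t ∈ Set.Icc 0 T, 0 < 1 + c * t) ∧
        ∀ t ∈ Set.Ico 0 T, q t = c / (1 + c * t) := by
      rcases hqC with ⟨C, hC, hqC⟩ | hq0
      · have hpos := fun t ht => one_add_mul_pos_of_notMem_Icc hC hT (t := t) ht
        refine ⟨C⁻¹, hpos, fun t ht => ?_⟩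
        have hC0 : C ≠ 0 := by
          rintro rfl
          exact hC ⟨by linarith, le_rfl⟩
        rw [hqC t ht]
        field_simp
        rw [add_comm]
      · exact ⟨0, by simp, fun t ht => by simp [hq0 t ht]⟩
    have hsq : Set.EqOn (fun t => σ t ^ 2) (fun _ => 1) (Set.Ico 0 T) := by
      intro t ht
      rcases hσ1 with h | h <;> simp [h t ht]
    -- The conditions concern `[0, T)`, while the covariance computation asks for them on `[0, T]`;
    -- continuity supplies the end point.
    have hcl : ∀ {f g : ℝ → ℝ}, ContinuousOn f (Set.Icc 0 T) → ContinuousOn g (Set.Icc 0 T) →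
        Set.EqOn f g (Set.Ico 0 T) → Set.EqOn f g (Set.Icc 0 T) := fun hf hg h =>
      h.of_subset_closure hf hg Set.Ico_subset_Icc_self (closure_Ico hT.ne).ge
    have hqc' := hcl hq' (continuousOn_const.div (by fun_prop) fun t ht => (hc t ht).ne') hqc
    have hσc' := hcl (hσ'.pow 2) continuousOn_const hsq
    intro s t h0 hst htT
    exact bridgeCov_of_eq_div hT (hc T (Set.right_mem_Icc.2 hT.le))
      (fun u hu => (constExt_of_nonneg hu.1).trans (hqc' hu))
      (fun u hu => by rw [constExt_of_nonneg hu.1]; exact hσc' hu)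
      ⟨h0, hst.trans htT⟩ ⟨h0.trans hst, htT⟩

end Characterization

end OUBridge

end

theorem theorem6 {Ω₁ Ω₂ Ω₃ Ω₄ : Type*} [MeasurableSpace Ω₁] [MeasurableSpace Ω₂]
    [MeasurableSpace Ω₃] [MeasurableSpace Ω₄]
    (P₁ : Measure Ω₁) [IsProbabilityMeasure P₁] (P₂ : Measure Ω₂) [IsProbabilityMeasure P₂]
    (P₃ : Measure Ω₃) [IsProbabilityMeasure P₃] (P₄ : Measure Ω₄) [IsProbabilityMeasure P₄]
    (T : ℝ) (hT : 0 < T) (q σ : ℝ → ℝ)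
    (hq : ContinuousOn q (Set.Ici 0)) (hσ : ContinuousOn σ (Set.Ici 0))
    (hσ0 : ∀ t, 0 ≤ t → σ t ≠ 0) (hq1 : ContDiffOn ℝ 1 q (Set.Ico 0 T))
    -- the process of Ornstein-Uhlenbeck type and its bridge from 0 to 0
    (B : ℝ≥0 → Ω₁ → ℝ) (Z : ℝ≥0 → Ω₁ → ℝ) (hZ : OUBridge.IsOUTypeProcess P₁ B q σ Z)
    (U : Set.Icc (0 : ℝ) T → Ω₂ → ℝ) (hU : OUBridge.IsOUBridge P₁ B q σ Z T 0 0 P₂ U)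
    -- the usual Wiener bridge from 0 to 0
    (B' : ℝ≥0 → Ω₃ → ℝ)
    (W : Set.Icc (0 : ℝ) T → Ω₄ → ℝ) (hW : OUBridge.IsWienerBridge P₃ B' T 0 0 P₄ W) :
    IdentDistrib (fun ω t => U t ω) (fun ω t => W t ω) P₂ P₄ ↔
      ((∃ C : ℝ, C ∉ Set.Icc (-T) 0 ∧ ∀ t ∈ Set.Ico 0 T, q t = 1 / (t + C)) ∨
          (∀ t ∈ Set.Ico 0 T, q t = 0)) ∧
        ((∀ t ∈ Set.Ico 0 T, σ t = 1) ∨ (∀ t ∈ Set.Ico 0 T, σ t = -1)) := by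
  obtain ⟨V, hV, hVU⟩ := hU.sameFDD
  obtain ⟨V', hV', hVW⟩ := hW.sameFDD
  rw [← OUBridge.bridgeCov_eq_iff hT hq hσ hσ0, ← OUBridge.sameFDD_iff_bridgeCov_eq
    hZ.isBrownian.toIsPreBrownianReal hW.isBrownian.toIsPreBrownianReal hT hq hσ hσ0 hV hV']
  -- Laws of `U` and `W` are compared through the integral processes `V` and `V'`, which have the
  -- same finite-dimensional distributions as `U` and `W` respectively.
  constructor
  · intro h
    exact (hVU.trans (OUBridge.sameFDD_of_identDistrib h)).trans hVW.symm
  · intro h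
    exact ((hVU.symm.trans h).trans hVW).identDistrib hU.measurable hW.measurable
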